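/- For a natural number $N$ let $(N)_2$ denote its canonical base-$2$ representation (most significant bit first, no leading zeros, $(0)_2$ being the empty string). Call $N$ a binary square if $N=0$ or $(N)_2=yy$ for some nonempty bit string $y$ that starts with $1$. Given an integer $N>686$, we can find an expression for $N$ as the sum of four binary squares in time linear in $\log N$. Precisely: there are a deterministic multi-stack (equivalently, multitape) Turing machine, with finitely many stacks, a finite control and finite stack alphabets, and a constant $C$ such that for every integer $N>686$ the machine, started on the input $(N)_2$, halts after at most $C\log N$ steps with output $(b_1)_2\#(b_2)_2\#(b_3)_2\#(b_4)_2\#$, where $b_1,b_2,b_3,b_4$ are binary squares (not necessarily distinct, $0$ allowed) with $b_1+b_2+b_3+b_4=N$. -/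

import Mathlib

/-- The canonical base-2 representation of `N`, most significant bit first, without leading
zeros; the representation of `0` is the empty string. -/
def binaryRep (N : ℕ) : List Bool := N.bits.reverse

/-- `N` is a binary square: `N = 0`, or the canonical base-2 representation of `N` is `y y`
for some nonempty bit string `y` that starts with a `1`. -/
def IsBinarySquare (N : ℕ) : Prop :=
  N = 0 ∨ ∃ y : List Bool, y.head? = some true ∧ binaryRep N = y ++ y

/-- A quadruple of natural numbers as a string over the three-letter alphabet `{0, 1, #}`
(`none` is the end marker `#`): the string `(v 0)₂ # (v 1)₂ # (v 2)₂ # (v 3)₂ #`. -/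
def encodeQuadruple (v : Fin 4 → ℕ) : List (Option Bool) :=
  (List.ofFn v).flatMap fun m => (binaryRep m).map some ++ [none]

/-! A nonzero root y of exactly j bits has square y(2^j + 1), so once the root lengths are fixed,
being a sum of binary squares is a linear equation in the roots. Cut a long N as 256P·hi + lo with P
a power of 2, where hi and lo have leading parts u and v at position P. The root lengths are chosen
to make the multipliers 128gP+1, 256P+1, 128P+1 and 16P+1. The first root is aP, with a chosen from
u so that its square leaves 400 ≤ 2u - ga ≤ 560. The rest is solved by y1 = 2hi - lo and y2 = 2lo -
2hi up to constants. Two null directions of the equation remain free: (-(128P+1), 256P+1) on (y1,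
y2), and (16P+1, -2(16P+1), 1) on (y1, y2, y3). Using them r and s times moves y2 by about 256rP -
32sP, which brings it into its window of lengths; the size of 2·y1 + y2 then places y1 as well
(`sum_rootVal`, `rootVal_bounds`).

Each root is therefore linear in hi and lo with tiny coefficients, plus constants inserted only at
positions 1 and P that depend on boundedly many bits of N. One pass with bounded carries produces
all four roots (`rootCols_val`), and a square is output by printing its root twice
(`binaryRep_binSq`). No multiplication occurs, so time is linear. The numbers below 2^20 are a
finite computation (`addSq_four`), stored as a table in the control. -/

/-- The binary square `y y` as a function of the number `y`. -/
def binSq (y : ℕ) : ℕ := y * (2 ^ y.size + 1)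

/-! ### Small numbers: a finite computation on bit sets -/

/-- Bit set of all sums of an element of the bit set `B` and some `binSq y`,
`lo ≤ y < lo + 2 ^ d`. -/
def sumSq (B : ℕ) : ℕ → ℕ → ℕ
  | 0, lo => B <<< (lo * (2 ^ (Nat.log2 lo + 1) + 1))
  | d + 1, lo => sumSq B d lo ||| sumSq B d (lo + 2 ^ d)

/-- Links the mathematical definition to the `Nat.log2` form in `sumSq`, which suits kernel
evaluation. -/
theorem binSq_eq_log2 {y : ℕ} (hy : y ≠ 0) : binSq y = y * (2 ^ (Nat.log2 y + 1) + 1) := by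
  have : y.size = Nat.log2 y + 1 := by
    apply le_antisymm
    · rw [Nat.size_le]; exact Nat.lt_log2_self
    · rw [Nat.succ_le_iff, Nat.lt_size]; exact Nat.log2_self_le hy
  rw [binSq, this]

theorem exists_of_testBit_sumSq (B : ℕ) : ∀ (d lo m : ℕ), lo ≠ 0 → (sumSq B d lo).testBit m →
    ∃ y, binSq y ≤ m ∧ B.testBit (m - binSq y)
  | 0, lo, m, h0, h => by
    rw [sumSq, ← binSq_eq_log2 h0, Nat.testBit_shiftLeft] at h
    simp only [Bool.and_eq_true, decide_eq_true_eq] at h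
    exact ⟨lo, h.1, h.2⟩
  | d + 1, lo, m, h0, h => by
    rw [sumSq, Nat.testBit_or, Bool.or_eq_true] at h
    rcases h with h | h
    · exact exists_of_testBit_sumSq B d lo m h0 h
    · exact exists_of_testBit_sumSq B d _ m (by positivity) h

/-- Bit set of the sums of an element of `B` and a binary square below `2 ^ 20`. -/
def addSq (B : ℕ) : ℕ :=
  B ||| sumSq B 9 1 ||| sumSq B 9 512

theorem exists_of_testBit_addSq {B m : ℕ} (h : (addSq B).testBit m) :
    ∃ y, binSq y ≤ m ∧ B.testBit (m - binSq y) := by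
  rw [addSq, Nat.testBit_or, Nat.testBit_or, Bool.or_eq_true, Bool.or_eq_true] at h
  rcases h with (h | h) | h
  · exact ⟨0, by simp [binSq], by simpa [binSq] using h⟩
  · exact exists_of_testBit_sumSq B 9 1 m (by omega) h
  · exact exists_of_testBit_sumSq B 9 512 m (by omega) h

/-- Starting from the bit set {0} and adding a square four times, bits 687 to 2^20 - 1 must all be
set. The reduction modulo a power of 2 discards the larger sums. -/
theorem addSq_four :
    Nat.beq ((addSq (addSq (addSq (addSq 1))) >>> 687) % 2 ^ (2 ^ 20 - 687))
      (2 ^ (2 ^ 20 - 687) - 1) = true := by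
  decide +kernel

theorem exists_four_binSq_small {N : ℕ} (h1 : 686 < N) (h2 : N < 2 ^ 20) :
    ∃ y : Fin 4 → ℕ, ∑ i, binSq (y i) = N := by
  have key : (addSq (addSq (addSq (addSq 1)))).testBit N := by
    have h := congrArg (fun x => Nat.testBit x (N - 687)) (Nat.eq_of_beq_eq_true addSq_four)
    simp only [Nat.testBit_mod_two_pow, Nat.testBit_shiftRight, Nat.testBit_two_pow_sub_one] at h
    rw [show 687 + (N - 687) = N by omega] at h
    have h3 : N - 687 < 2 ^ 20 - 687 := by omega
    simpa only [h3, decide_true, Bool.true_and] using h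
  obtain ⟨a, ha, h⟩ := exists_of_testBit_addSq key
  obtain ⟨b, hb, h⟩ := exists_of_testBit_addSq h
  obtain ⟨c, hc, h⟩ := exists_of_testBit_addSq h
  obtain ⟨d, hd, h⟩ := exists_of_testBit_addSq h
  rw [Nat.testBit_one_eq_true_iff_self_eq_zero] at h
  refine ⟨![a, b, c, d], ?_⟩
  simp only [Fin.sum_univ_four, Matrix.cons_val]
  omega

/-! ### Choice of the four roots and their sizes -/

/-- The coefficients that choose the three small squares: `g` and `a` describe the first square,
`E` fixes the residue. -/
structure Coeffs where
  g : ℤ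
  a : ℤ
  E : ℤ

namespace Coeffs

/-- The digits of E / 32 = s - 8r with 0 ≤ s ≤ 7: these are the multiples of the two null directions
that reduce the leading part of the third root to E % 32 above its base. -/
def s (p : Coeffs) : ℤ := p.E / 32 % 8

def r (p : Coeffs) : ℤ := -(p.E / 32 / 8)

/-- Additive constants at the lowest position. -/
def low (p : Coeffs) : Fin 4 → ℤ := ![0, p.s - p.r, p.r - 2 * p.s, p.s]

/-- Additive constants at position `P = 2 ^ (k - 8)`. -/
def high (p : Coeffs) : Fin 4 → ℤ :=
  ![p.a, (1 - p.g) * p.a + 7 + 16 * p.s - 128 * p.r,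
    (p.g - 2) * p.a - 32 * p.s - 15 + 256 * p.r, 8]

end Coeffs

/-- Coefficients of the upper part of the input. -/
def hiCoeff : Fin 4 → ℤ := ![0, 2, -2, 0]

/-- Coefficients of the lower part of the input. -/
def loCoeff : Fin 4 → ℤ := ![0, -1, 2, 0]

/-- The coefficients as functions of the leading bits `u` and `v` of the two parts of the input,
its length being even or odd; `C` says whether the first square is much longer than the others. -/
def mkCoeffs (C even : Bool) (u v : ℤ) : Coeffs :=
  let g : ℤ := if C then 16 else if !even && decide (u < 328) then 1 else 2
  let a : ℤ := if C then (u - 208) / 8 else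
    if !even && decide (u < 328) then (if u < 288 then 64 else 127) else min (u - 200) 255
  { g := g, a := a, E := 2 * v - 2 * u + (g - 2) * a - 15 - (if C then 72 else 84) }

/-- The roots of the four squares. -/
def rootVal (p : Coeffs) (P hi lo : ℤ) (i : Fin 4) : ℤ :=
  hiCoeff i * hi + loCoeff i * lo + p.low i + p.high i * P

/-- An identity in all parameters: the terms in r and s cancel as null directions, and those in a
compensate the first square. -/
theorem sum_rootVal (p : Coeffs) (P hi lo : ℤ) :
    rootVal p P hi lo 0 * (128 * p.g * P + 1) + rootVal p P hi lo 1 * (256 * P + 1)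
      + rootVal p P hi lo 2 * (128 * P + 1) + rootVal p P hi lo 3 * (16 * P + 1)
      = 256 * P * hi + lo := by
  simp [rootVal, hiCoeff, loCoeff, Coeffs.low, Coeffs.high]
  ring

/-- The number `be` is the base of the window for y2 / P. Two bases are needed because of small P,
where the additive constant r - 2s matters: for r up to 19 the base 84 could exceed 128P, while the
base 72 is safe from below only because r ≥ 8. -/
theorem bounds_rootVal_aux {g a E be u v P h l : ℤ} (hP : 1 ≤ P)
    (hh : 0 ≤ h ∧ h < P) (hl : 0 ≤ l ∧ l < P)
    (hE : E = 2 * v - 2 * u + (g - 2) * a - 15 - be)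
    (hA : 400 ≤ 2 * u - g * a) (hA' : 2 * u - g * a ≤ 560)
    (hbe : be = 84 ∧ 0 ≤ -(E / 32 / 8) ∧ -(E / 32 / 8) ≤ 6 ∨
      be = 72 ∧ 8 ≤ -(E / 32 / 8) ∧ -(E / 32 / 8) ≤ 19 ∧ 416 ≤ 2 * u - g * a) :
    let p : Coeffs := ⟨g, a, E⟩
    (128 * P ≤ rootVal p P (u * P + h) (v * P + l) 1 ∧
      rootVal p P (u * P + h) (v * P + l) 1 < 256 * P) ∧
    (64 * P ≤ rootVal p P (u * P + h) (v * P + l) 2 ∧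
      rootVal p P (u * P + h) (v * P + l) 2 < 128 * P) ∧
    (8 * P ≤ rootVal p P (u * P + h) (v * P + l) 3 ∧
      rootVal p P (u * P + h) (v * P + l) 3 < 16 * P) := by
  intro p
  have hs0 : 0 ≤ p.s := Int.emod_nonneg _ (by norm_num)
  have hs7 : p.s ≤ 7 := Int.le_of_lt_add_one (Int.emod_lt_of_pos _ (by norm_num))
  have hr : p.r = -(E / 32 / 8) := rfl
  have hEs : E = 32 * (8 * -p.r + p.s) + E % 32 := by
    simp only [hr, Coeffs.s, p]; omega
  rw [← hr] at hbe
  have hm0 : 0 ≤ E % 32 := Int.emod_nonneg _ (by norm_num)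
  have hm1 : E % 32 ≤ 31 := by omega
  set r := p.r
  set s := p.s
  -- The choice of r and s leaves only E % 32 above the base, so y2 varies by little more than 32P.
  have h2 : rootVal p P (u * P + h) (v * P + l) 2
      = (be + E % 32) * P + (2 * l - 2 * h) + (r - 2 * s) := by
    have : be + E % 32 = 2 * v - 2 * u + (g - 2) * a - 15 + 32 * (8 * r - s) := by omega
    simp [rootVal, hiCoeff, loCoeff, Coeffs.low, Coeffs.high, this, r, p]
    ring
  -- In 2·y1 + y2 the lower part of the input and s cancel, so bounds on 2u - ga and y2 bound y1.
  have h1 : 2 * rootVal p P (u * P + h) (v * P + l) 1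
      = (2 * u - g * a - 1) * P + 2 * h - r - rootVal p P (u * P + h) (v * P + l) 2 := by
    simp [rootVal, hiCoeff, loCoeff, Coeffs.low, Coeffs.high, r, p]
    ring
  have h3 : rootVal p P (u * P + h) (v * P + l) 3 = 8 * P + s := by
    simp [rootVal, hiCoeff, loCoeff, Coeffs.low, Coeffs.high, s]
    ring
  have hA1 : (2 * u - g * a) * P ≤ 560 * P := by gcongr
  have hm2 : E % 32 * P ≤ 31 * P := by gcongr
  have hm3 : 0 ≤ E % 32 * P := by positivity
  have hD : (be + E % 32) * P = be * P + E % 32 * P := by ring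
  have hA2 : (2 * u - g * a - 1) * P = (2 * u - g * a) * P - P := by ring
  rw [hA2] at h1
  rw [hD] at h2
  rw [h3]
  generalize rootVal p P (u * P + h) (v * P + l) 1 = c at *
  generalize rootVal p P (u * P + h) (v * P + l) 2 = d at *
  rcases hbe with ⟨rfl, hr0, hr1⟩ | ⟨rfl, hr0, hr1, hA3⟩
  · have hA4 : 400 * P ≤ (2 * u - g * a) * P := by gcongr
    generalize (2 * u - g * a) * P = x at *
    generalize E % 32 * P = y at *
    omega
  · have hA4 : 416 * P ≤ (2 * u - g * a) * P := by gcongr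
    generalize (2 * u - g * a) * P = x at *
    generalize E % 32 * P = y at *
    omega

/-- The range of the leading bits `u` of the upper part, in the three modes. -/
def Admissible (C even : Bool) (u : ℤ) : Prop :=
  if C then 8448 ≤ u ∧ u < 16384
  else if even then 512 ≤ u ∧ u < 528
  else 256 ≤ u ∧ u < 512

theorem rootVal_bounds {C even : Bool} {u v P h l : ℤ} (hu : Admissible C even u)
    (hv : 0 ≤ v ∧ v < 256) (hP : 1 ≤ P) (hh : 0 ≤ h ∧ h < P) (hl : 0 ≤ l ∧ l < P) :
    let p := mkCoeffs C even u v
    let y := rootVal p P (u * P + h) (v * P + l)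
    (p.g = 1 ∨ p.g = 2 ∨ p.g = 16 ∧ C = true) ∧
    (64 * p.g * P ≤ y 0 ∧ y 0 < 128 * p.g * P) ∧
    (128 * P ≤ y 1 ∧ y 1 < 256 * P) ∧ (64 * P ≤ y 2 ∧ y 2 < 128 * P) ∧
    (8 * P ≤ y 3 ∧ y 3 < 16 * P) := by
  intro p y
  have hy0 : y 0 = p.a * P := by simp [y, rootVal, hiCoeff, loCoeff, Coeffs.low, Coeffs.high]
  suffices H : (p.g = 1 ∨ p.g = 2 ∨ p.g = 16 ∧ C = true) ∧ (64 * p.g ≤ p.a ∧ p.a < 128 * p.g) ∧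
      400 ≤ 2 * u - p.g * p.a ∧ 2 * u - p.g * p.a ≤ 560 ∧
      ∃ be, p.E = 2 * v - 2 * u + (p.g - 2) * p.a - 15 - be ∧
        (be = 84 ∧ 0 ≤ -(p.E / 32 / 8) ∧ -(p.E / 32 / 8) ≤ 6 ∨
      be = 72 ∧ 8 ≤ -(p.E / 32 / 8) ∧ -(p.E / 32 / 8) ≤ 19 ∧ 416 ≤ 2 * u - p.g * p.a) by
    obtain ⟨hg, ⟨ha, ha'⟩, hA, hA', be, hE, hbe⟩ := H
    refine ⟨hg, ⟨?_, ?_⟩, bounds_rootVal_aux hP hh hl hE hA hA' hbe⟩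
    · rw [hy0]; gcongr
    · rw [hy0]; gcongr
  unfold Admissible at hu
  rcases C with _ | _
  -- For u < 328 the choice a = u - 200 would fall below 128, the least value for g = 2, so the
  -- first root is made one bit shorter there.
  · by_cases hc : (!even && decide (u < 328)) = true
    · have hg : p.g = 1 := by simp only [p, mkCoeffs, hc]; rfl
      have ha : p.a = if u < 288 then 64 else 127 := by simp only [p, mkCoeffs, hc]; rfl
      have hE : p.E = 2 * v - 2 * u + (p.g - 2) * p.a - 15 - 84 := by rfl
      simp only [Bool.and_eq_true, decide_eq_true_eq, Bool.not_eq_true'] at hc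
      simp [hc.1] at hu
      have ha' : (u < 288 ∧ p.a = 64) ∨ (288 ≤ u ∧ p.a = 127) := by
        rw [ha]; split_ifs <;> omega
      generalize p.a = a at *
      generalize p.E = E at *
      rw [hg] at *
      refine ⟨by omega, by omega, by omega, by omega, 84, hE, by omega⟩
    · have hg : p.g = 2 := by simp only [p, mkCoeffs, hc]; rfl
      have ha : p.a = min (u - 200) 255 := by simp only [p, mkCoeffs, hc]; rfl
      have hE : p.E = 2 * v - 2 * u + (p.g - 2) * p.a - 15 - 84 := by rfl
      have hu' : 328 ≤ u ∧ u < 528 := by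
        cases even <;> simp at hc hu <;> omega
      generalize p.a = a at *
      generalize p.E = E at *
      rw [hg] at *
      refine ⟨by omega, by omega, by omega, by omega, 84, hE, by omega⟩
  -- Here a rounds so that 2u - 16a lies between 416 and 430; r is larger in this mode, hence the
  -- base 72.
  · have hg : p.g = 16 := rfl
    have ha : p.a = (u - 208) / 8 := rfl
    have hE : p.E = 2 * v - 2 * u + (p.g - 2) * p.a - 15 - 72 := by rfl
    simp at hu
    generalize p.a = a at *
    generalize p.E = E at *
    rw [hg] at *
    refine ⟨by simp, by omega, by omega, by omega, 72, hE, by omega⟩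

/-! ### Values of bit strings and the representation of squares -/

/-- The value of a list of bits, least significant bit first. -/
def bitsVal : List Bool → ℕ
  | [] => 0
  | b :: l => Nat.bit b (bitsVal l)

/-- The value of a list of bits, most significant bit first. -/
def msbVal (l : List Bool) : ℕ := bitsVal l.reverse

theorem bitsVal_cons (b : Bool) (l : List Bool) : bitsVal (b :: l) = b.toNat + 2 * bitsVal l := by
  rw [bitsVal, Nat.bit_val]; omega

theorem bitsVal_append (l m : List Bool) :
    bitsVal (l ++ m) = bitsVal l + 2 ^ l.length * bitsVal m := by
  induction l with
  | nil => simp [bitsVal]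
  | cons b l ih => rw [List.cons_append, bitsVal_cons, bitsVal_cons, ih, List.length_cons]; ring

theorem bitsVal_lt (l : List Bool) : bitsVal l < 2 ^ l.length := by
  induction l with
  | nil => simp [bitsVal]
  | cons b l ih =>
    rw [bitsVal_cons, List.length_cons, pow_succ]
    have := b.toNat_le
    omega

theorem bitsVal_bits (N : ℕ) : bitsVal N.bits = N := by
  induction N using Nat.binaryRec' with
  | zero => simp [bitsVal]
  | bit b n h ih => rw [Nat.bits_append_bit _ _ h, bitsVal, ih]

theorem msbVal_append (l m : List Bool) : msbVal (l ++ m) = msbVal l * 2 ^ m.length + msbVal m := by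
  rw [msbVal, List.reverse_append, bitsVal_append, List.length_reverse, msbVal, msbVal]; ring

theorem msbVal_lt (l : List Bool) : msbVal l < 2 ^ l.length := by
  simpa [msbVal] using bitsVal_lt l.reverse

theorem msbVal_binaryRep (N : ℕ) : msbVal (binaryRep N) = N := by
  simp [msbVal, binaryRep, bitsVal_bits]

theorem length_binaryRep (N : ℕ) : (binaryRep N).length = N.size := by
  simp [binaryRep, Nat.size_eq_bits_len]

/-- Justifies printing a root from fixed-width columns and then trimming leading zeros. -/
theorem binaryRep_bitsVal (l : List Bool) :
    binaryRep (bitsVal l) = l.reverse.dropWhile (!·) := by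
  induction l with
  | nil => simp [bitsVal, binaryRep]
  | cons b l ih =>
    rw [List.reverse_cons, List.dropWhile_append, ← ih, bitsVal]
    by_cases h : bitsVal l = 0 → b = true
    · rw [binaryRep, Nat.bits_append_bit _ _ h, List.reverse_cons, binaryRep]
      by_cases h0 : bitsVal l = 0
      · simp [h0, h h0]
      · have : (bitsVal l).bits ≠ [] := fun h => h0 (by rw [← bitsVal_bits (bitsVal l), h, bitsVal])
        simp [this]
    · push Not at h
      obtain ⟨h0, hb⟩ := h
      simp at hb
      simp [h0, hb, binaryRep]

theorem binaryRep_pos_head {y : ℕ} (hy : y ≠ 0) : (binaryRep y).head? = some true := by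
  have h : binaryRep y = (binaryRep y).dropWhile (!·) := by
    conv_lhs => rw [← bitsVal_bits y, binaryRep_bitsVal]
    rfl
  cases hb : binaryRep y with
  | nil => exact absurd (by rw [← msbVal_binaryRep y, hb]; rfl) hy
  | cons b l =>
    rw [hb] at h
    cases b with
    | true => rfl
    | false =>
      have := congrArg List.length h
      have h2 := (List.dropWhile_sublist (p := (!·)) (l := l)).length_le
      simp at this
      omega

theorem binaryRep_binSq (y : ℕ) : binaryRep (binSq y) = binaryRep y ++ binaryRep y := by
  by_cases hy : y = 0
  · subst hy; simp [binSq, binaryRep]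
  have h : binSq y = bitsVal (y.bits ++ y.bits) := by
    rw [bitsVal_append, bitsVal_bits, Nat.size_eq_bits_len, binSq]; ring
  have h2 := binaryRep_pos_head hy
  rw [h, binaryRep_bitsVal, List.reverse_append]
  change (binaryRep y ++ binaryRep y).dropWhile _ = _
  revert h2
  generalize binaryRep y = l
  cases l with
  | nil => simp
  | cons b l => simp +contextual

theorem isBinarySquare_binSq (y : ℕ) : IsBinarySquare (binSq y) := by
  by_cases hy : y = 0
  · subst hy; left; simp [binSq]
  · exact Or.inr ⟨_, binaryRep_pos_head hy, binaryRep_binSq y⟩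

/-! ### The adder with carries -/

/-- The output digits of the adder, given the carries and one bit of each part of the input. -/
def sumDigit (c : Fin 4 → ℤ) (h l : Bool) (i : Fin 4) : Bool :=
  decide ((hiCoeff i * h.toNat + loCoeff i * l.toNat + c i) % 2 = 1)

/-- The new carries of the adder. -/
def sumCarry (c : Fin 4 → ℤ) (h l : Bool) (i : Fin 4) : ℤ :=
  (hiCoeff i * h.toNat + loCoeff i * l.toNat + c i) / 2

/-- The columns written by the adder. -/
def sumCols (c : Fin 4 → ℤ) : List (Bool × Bool) → List (Fin 4 → Bool)
  | [] => []
  | (h, l) :: ps => sumDigit c h l :: sumCols (sumCarry c h l) ps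

/-- The carries at the end. -/
def endCarry (c : Fin 4 → ℤ) : List (Bool × Bool) → Fin 4 → ℤ
  | [] => c
  | (h, l) :: ps => endCarry (sumCarry c h l) ps

theorem length_sumCols (c : Fin 4 → ℤ) (ps) : (sumCols c ps).length = ps.length := by
  induction ps generalizing c with
  | nil => rfl
  | cons p ps ih => simp [sumCols, ih]

/-- Each step preserves digit + 2·carry, so digits and final carry together hold the exact, possibly
negative, value. -/
theorem sumCols_val (c : Fin 4 → ℤ) (ps : List (Bool × Bool)) (i : Fin 4) :
    (bitsVal ((sumCols c ps).map (· i)) : ℤ) + 2 ^ ps.length * endCarry c ps i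
      = c i + hiCoeff i * bitsVal (ps.map Prod.fst) + loCoeff i * bitsVal (ps.map Prod.snd) := by
  induction ps generalizing c with
  | nil => simp [sumCols, endCarry, bitsVal]
  | cons p ps ih =>
    obtain ⟨h, l⟩ := p
    have ih := ih (sumCarry c h l)
    simp only [sumCols, endCarry, List.map_cons, bitsVal_cons, List.length_cons, pow_succ]
    push_cast
    have hd : ((sumDigit c h l i).toNat : ℤ) + 2 * sumCarry c h l i
        = hiCoeff i * h.toNat + loCoeff i * l.toNat + c i := by
      rw [sumDigit, sumCarry]
      generalize hiCoeff i * h.toNat + loCoeff i * l.toNat + c i = x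
      by_cases hx : x % 2 = 1
      · simp [hx]; omega
      · simp [hx]; omega
    linear_combination 2 * ih + hd

theorem abs_coeff_le (h l : Bool) (i : Fin 4) :
    |hiCoeff i * h.toNat + loCoeff i * l.toNat| ≤ 2 := by
  fin_cases i <;> cases h <;> cases l <;> simp [hiCoeff, loCoeff]

/-- A step adds at most 2 and halves, so carries never grow and a finite control can hold them. -/
theorem abs_sumCarry_le {M : ℤ} (hM : 3 ≤ M) {c : Fin 4 → ℤ} (hc : ∀ i, |c i| ≤ M) (h l : Bool)
    (i : Fin 4) : |sumCarry c h l i| ≤ M := by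
  have h1 := abs_coeff_le h l i
  have h2 := hc i
  rw [sumCarry]
  generalize hiCoeff i * h.toNat + loCoeff i * l.toNat = x at *
  rw [abs_le] at *
  omega

theorem abs_endCarry_le {M : ℤ} (hM : 3 ≤ M) {c : Fin 4 → ℤ} (hc : ∀ i, |c i| ≤ M)
    (ps : List (Bool × Bool)) (i : Fin 4) : |endCarry c ps i| ≤ M := by
  induction ps generalizing c with
  | nil => exact hc i
  | cons p ps ih => exact ih (abs_sumCarry_le hM hc p.1 p.2)

/-! ### From the input pieces to four squares with the right sum -/

theorem binSq_eq_of_bounds {y j : ℕ} (h1 : 2 ^ j ≤ y) (h2 : y < 2 ^ (j + 1)) :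
    binSq y = y * (2 ^ (j + 1) + 1) := by
  have : y.size = j + 1 := le_antisymm (Nat.size_le.2 h2) (Nat.lt_size.2 h1)
  rw [binSq, this]

theorem binSq_cast_of_bounds {y m : ℕ} {Y c : ℤ} (j : ℕ) (hy : (y : ℤ) = Y) (hc : c = 2 ^ j)
    (h1 : c * 2 ^ m ≤ Y) (h2 : Y < 2 * c * 2 ^ m) : (binSq y : ℤ) = Y * (2 * c * 2 ^ m + 1) := by
  subst hy hc
  rw [binSq_eq_of_bounds (j := j + m)]
  · push_cast; ring
  · rw [pow_add]; exact_mod_cast h1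
  · rw [pow_succ, pow_add]; zify; linarith

/-- Whether the input starts with a bit string that calls for a long first square. -/
def isLong (T : List Bool) (even : Bool) : Bool := even && decide (33 ≤ msbVal (T.take 6))

/-- The number of leading bits that make up `u`. -/
def leadLen (T : List Bool) (even : Bool) : ℕ :=
  if isLong T even then 14 else if even then 10 else 9

/-- The coefficients, given the leading bits of the input and of its lower part. -/
def coeffs (T : List Bool) (even : Bool) (V : List Bool) : Coeffs :=
  mkCoeffs (isLong T even) even (msbVal (T.take (leadLen T even))) (msbVal V)

/-- The carries that enter the addition at the position of `u` and `v`. -/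
def midCarry (T : List Bool) (even : Bool) (V : List Bool) (i : Fin 4) : ℤ :=
  (coeffs T even V).high i + loCoeff i * msbVal V

/-- The columns of the four roots. -/
def rootCols (T : List Bool) (even : Bool) (V U H L : List Bool) : List (Fin 4 → Bool) :=
  let p := coeffs T even V
  let ps := H.reverse.zip L.reverse
  sumCols p.low ps ++
    sumCols (endCarry p.low ps + midCarry T even V) (U.reverse.map fun b => (b, false))

/-- The columns are right modulo 2^|U|·P. Since the root lies in [0, 2^|U|·P), the final carry
vanishes and they are exact. -/
theorem rootCols_val {T V U H L : List Bool} {even : Bool} {P : ℤ} (hHL : H.length = L.length)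
    (hP : P = 2 ^ H.length) (i : Fin 4)
    (h0 : 0 ≤ rootVal (coeffs T even V) P (msbVal U * P + msbVal H) (msbVal V * P + msbVal L) i)
    (h1 : rootVal (coeffs T even V) P (msbVal U * P + msbVal H) (msbVal V * P + msbVal L) i
      < 2 ^ U.length * P) :
    (bitsVal ((rootCols T even V U H L).map (· i)) : ℤ)
      = rootVal (coeffs T even V) P (msbVal U * P + msbVal H) (msbVal V * P + msbVal L) i := by
  have e1 := sumCols_val (coeffs T even V).low (H.reverse.zip L.reverse) i
  have e2 := sumCols_val
    (endCarry (coeffs T even V).low (H.reverse.zip L.reverse) + midCarry T even V)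
    (U.reverse.map fun b => (b, false)) i
  have hl : (H.reverse.zip L.reverse).length = H.length := by simp [hHL]
  have hf : bitsVal ((U.reverse.map fun b => (b, false)).map Prod.snd) = 0 := by
    rw [List.map_map]
    generalize U.reverse = l
    induction l with
    | nil => rfl
    | cons b l ih => simp [bitsVal, ih]
  rw [hf] at e2
  rw [List.map_fst_zip (by simp [hHL]), List.map_snd_zip (by simp [hHL]), hl] at e1
  have hu : ((U.reverse.map fun b => (b, false)).map Prod.fst) = U.reverse := by
    simp [List.map_map, Function.comp_def]
  rw [hu] at e2
  simp only [List.length_map, List.length_reverse, Pi.add_apply, midCarry] at e2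
  simp only [rootCols, List.map_append, bitsVal_append, List.length_map, length_sumCols, hl]
  have hlt : (bitsVal ((sumCols (coeffs T even V).low (H.reverse.zip L.reverse)).map (· i)) : ℤ)
      + P * bitsVal ((sumCols (endCarry (coeffs T even V).low (H.reverse.zip L.reverse)
        + midCarry T even V) (U.reverse.map fun b => (b, false))).map (· i))
      < 2 ^ U.length * P := by
    have h3 := bitsVal_lt ((rootCols T even V U H L).map (· i))
    simp only [rootCols, List.map_append, bitsVal_append, List.length_map, length_sumCols, hl,
      List.length_append, List.length_reverse] at h3
    rw [hP, mul_comm (2 ^ U.length), ← pow_add]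
    exact_mod_cast h3
  push_cast
  rw [← hP] at e1 ⊢
  simp only [msbVal] at *
  generalize bitsVal ((sumCols (coeffs T even V).low (H.reverse.zip L.reverse)).map (· i))
    = x at *
  generalize bitsVal ((sumCols (endCarry (coeffs T even V).low (H.reverse.zip L.reverse)
        + midCarry T even V) (U.reverse.map fun b => (b, false))).map (· i)) = y at *
  generalize endCarry (endCarry (coeffs T even V).low (H.reverse.zip L.reverse)
        + midCarry T even V) (U.reverse.map fun b => (b, false)) i = z at *
  have e3 : rootVal (coeffs T even V) P (bitsVal U.reverse * P + bitsVal H.reverse)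
      (bitsVal V.reverse * P + bitsVal L.reverse) i = x + P * y + 2 ^ U.length * P * z := by
    rw [rootVal]
    linear_combination -e1 - P * e2
  rw [e3] at h0 h1 ⊢
  have hQ : 0 < 2 ^ U.length * P := by rw [hP]; positivity
  have hx : 0 ≤ x + P * y := by
    have hP0 : 0 ≤ P := by rw [hP]; positivity
    positivity
  -- Both x + P·y and x + P·y + 2^|U|·P·z lie in an interval of length 2^|U|·P.
  have hz : z = 0 := by
    have : z < 1 := by
      by_contra hz
      have : 2 ^ U.length * P * 1 ≤ 2 ^ U.length * P * z := by gcongr; omega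
      linarith
    have : -1 < z := by
      by_contra hz
      have : 2 ^ U.length * P * z ≤ 2 ^ U.length * P * (-1) := by gcongr; omega
      linarith
    omega
  rw [hz]; ring

theorem sum_binSq_rootCols {T V U H L : List Bool} {even : Bool} (hHL : H.length = L.length)
    (hV : V.length = 8) (hU : U = T.take (leadLen T even))
    (hadm : Admissible (isLong T even) even (msbVal U)) :
    ∑ i, binSq (bitsVal ((rootCols T even V U H L).map (· i))) = msbVal (U ++ H ++ V ++ L) := by
  obtain ⟨P, hP⟩ : ∃ P : ℤ, P = 2 ^ H.length := ⟨_, rfl⟩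
  have hP1 : 1 ≤ P := by rw [hP]; exact_mod_cast Nat.one_le_two_pow
  have hh : (0 : ℤ) ≤ msbVal H ∧ (msbVal H : ℤ) < P :=
    ⟨by positivity, by rw [hP]; exact_mod_cast msbVal_lt H⟩
  have hl : (0 : ℤ) ≤ msbVal L ∧ (msbVal L : ℤ) < P :=
    ⟨by positivity, by rw [hP, hHL]; exact_mod_cast msbVal_lt L⟩
  have hv : (0 : ℤ) ≤ msbVal V ∧ (msbVal V : ℤ) < 256 := by
    have := msbVal_lt V
    rw [hV] at this
    exact ⟨by positivity, by exact_mod_cast this⟩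
  have hu : (msbVal U : ℤ) < 2 ^ U.length := by exact_mod_cast msbVal_lt U
  have key := rootVal_bounds hadm hv hP1 hh hl
  have hval := fun i => rootCols_val (T := T) (V := V) (U := U) (even := even) hHL hP i
  have hp : mkCoeffs (isLong T even) even (msbVal U) (msbVal V) = coeffs T even V := by
    rw [coeffs, hU]
  simp only [hp] at key
  have hsum := sum_rootVal (coeffs T even V) P (msbVal U * P + msbVal H) (msbVal V * P + msbVal L)
  generalize rootVal (coeffs T even V) P (msbVal U * P + msbVal H) (msbVal V * P + msbVal L)
    = y at *
  generalize (coeffs T even V).g = g at *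
  obtain ⟨hg, ⟨h00, h01⟩, ⟨h10, h11⟩, ⟨h20, h21⟩, ⟨h30, h31⟩⟩ := key
  -- The column width suffices because u itself is large and u < 2^|U|.
  have hlen : 128 * g ≤ 2 ^ U.length ∧ (256 : ℤ) ≤ 2 ^ U.length := by
    unfold Admissible at hadm
    generalize isLong T even = C at *
    cases C <;> cases even <;> simp at hadm hg <;> omega
  have hlen1 : 128 * g * P ≤ 2 ^ U.length * P := 
    mul_le_mul_of_nonneg_right hlen.1 (by linarith)
  have hlen2 : 256 * P ≤ 2 ^ U.length * P := 
    mul_le_mul_of_nonneg_right hlen.2 (by linarith)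
  have hgP : 0 ≤ 64 * g * P := by rcases hg with rfl | rfl | ⟨rfl, -⟩ <;> positivity
  have e0 := hval 0 (by linarith) (by linarith)
  have e1 := hval 1 (by linarith) (by linarith)
  have e2 := hval 2 (by linarith) (by linarith)
  have e3 := hval 3 (by linarith) (by linarith)
  rw [hP] at *
  have f0 : (binSq (bitsVal ((rootCols T even V U H L).map (· 0))) : ℤ)
      = y 0 * (2 * (64 * g) * 2 ^ H.length + 1) := by
    rcases hg with rfl | rfl | ⟨rfl, -⟩
    · exact binSq_cast_of_bounds 6 e0 (by norm_num) (by linarith) (by linarith)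
    · exact binSq_cast_of_bounds 7 e0 (by norm_num) (by linarith) (by linarith)
    · exact binSq_cast_of_bounds 10 e0 (by norm_num) (by linarith) (by linarith)
  have f1 := binSq_cast_of_bounds (c := 128) (m := H.length) 7 e1 (by norm_num)
    (by linarith) (by linarith)
  have f2 := binSq_cast_of_bounds (c := 64) (m := H.length) 6 e2 (by norm_num)
    (by linarith) (by linarith)
  have f3 := binSq_cast_of_bounds (c := 8) (m := H.length) 3 e3 (by norm_num)
    (by linarith) (by linarith)
  zify
  rw [Fin.sum_univ_four, f0, f1, f2, f3]
  simp only [msbVal_append, ← hHL, hV]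
  push_cast
  linear_combination hsum

/-- The length of the lower part of the input. -/
def lowLen (T : List Bool) (even : Bool) (n : ℕ) : ℕ :=
  (n + 1) / 2 - (if isLong T even then 3 else 1)

/-- For even length, six leading bits decide: 100000 confines u to [512, 528), anything larger gives
u ≥ 33·2^8 = 8448. -/
theorem admissible_of_head {bs : List Bool} (hb : bs.head? = some true) (hn : 21 ≤ bs.length)
    (even : Bool) : Admissible (isLong (bs.take 21) even) even
      (msbVal ((bs.take 21).take (leadLen (bs.take 21) even))) := by
  have hlow : ∀ j, j < 21 → 2 ^ j ≤ msbVal (bs.take (j + 1)) := by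
    intro j _
    cases bs with
    | nil => simp at hb
    | cons b l =>
      simp at hb
      subst hb
      rw [List.take_succ_cons, ← List.singleton_append, msbVal_append, List.length_take, min_eq_left]
      · simp [msbVal, bitsVal]
      · simp at hn; omega
  have hup : ∀ j, msbVal (bs.take j) < 2 ^ j := fun j =>
    (msbVal_lt _).trans_le (Nat.pow_le_pow_right (by norm_num) (by simp))
  have hpre : ∀ j, 6 ≤ j → j ≤ 21 → msbVal (bs.take 6) * 2 ^ (j - 6) ≤ msbVal (bs.take j) ∧
      msbVal (bs.take j) < (msbVal (bs.take 6) + 1) * 2 ^ (j - 6) := by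
    intro j h6 hj
    have : bs.take j = bs.take 6 ++ (bs.drop 6).take (j - 6) := by
      rw [← List.take_add, Nat.add_sub_cancel' h6]
    have h2 := msbVal_lt ((bs.drop 6).take (j - 6))
    have hl : ((bs.drop 6).take (j - 6)).length = j - 6 := by simp; omega
    rw [this, msbVal_append, hl, add_mul]
    rw [hl] at h2
    omega
  simp only [Admissible, leadLen, isLong, List.take_take]
  have a := hlow 8 (by norm_num)
  have b := hup 9
  have d := hup 14
  have e := hpre 10 (by norm_num) (by norm_num)
  have f := hpre 14 (by norm_num) (by norm_num)
  have g := hlow 9 (by norm_num)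
  norm_num at *
  cases even
  · simp; omega
  · by_cases h : 33 ≤ msbVal (bs.take 6)
    · simp [h]; omega
    · simp [h]; omega

theorem sum_binSq_rootCols_of_split {bs U H V L : List Bool} (hb : bs.head? = some true)
    (hn : 21 ≤ bs.length) (even : Bool) (hU : U = bs.take (leadLen (bs.take 21) even))
    (hHL : H.length = L.length) (hV : V.length = 8) (hbs : bs = U ++ H ++ V ++ L) :
    ∑ i, binSq (bitsVal ((rootCols (bs.take 21) even V U H L).map (· i))) = msbVal bs := by
  have hw : leadLen (bs.take 21) even ≤ 21 := by unfold leadLen; split_ifs <;> norm_num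
  have hU' : U = (bs.take 21).take (leadLen (bs.take 21) even) := by
    rw [List.take_take, min_eq_left hw, hU]
  rw [sum_binSq_rootCols hHL hV hU', ← hbs]
  rw [hU']
  exact admissible_of_head hb hn even

/-! ### The stack machine -/

open Turing StateTransition

/-- `f` leads from `a` to `b` in at most `t` steps. -/
def ReachesIn {S : Type*} (f : S → Option S) (a b : S) (t : ℕ) : Prop :=
  Nonempty (EvalsToInTime f a (some b) t)

namespace ReachesIn

variable {S : Type*} {f : S → Option S}

theorem refl (a : S) : ReachesIn f a a 0 := ⟨EvalsToInTime.refl f a⟩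

theorem trans {a b c : S} {s t : ℕ} (h₁ : ReachesIn f a b s) (h₂ : ReachesIn f b c t) :
    ReachesIn f a c (s + t) :=
  let ⟨h₁⟩ := h₁
  let ⟨h₂⟩ := h₂
  ⟨add_comm t s ▸ EvalsToInTime.trans f s t a b (some c) h₁ h₂⟩

theorem single {a b : S} (h : f a = some b) : ReachesIn f a b 1 :=
  ⟨⟨⟨1, h⟩, le_rfl⟩⟩

end ReachesIn

/-- The stacks: input, output, unary counter, upper part, lower part, and two stacks of columns. -/
inductive Stk
  | inp | out | tick | hi | lo | fwd | bwd
  deriving DecidableEq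

instance : Fintype Stk :=
  ⟨{.inp, .out, .tick, .hi, .lo, .fwd, .bwd}, fun k => by cases k <;> decide⟩

/-- The symbols on a stack. -/
abbrev StkSym : Stk → Type
  | .inp => Bool
  | .out => Option Bool
  | .tick => Unit
  | .hi => Bool
  | .lo => Bool
  | .fwd => Fin 4 → Bool
  | .bwd => Fin 4 → Bool

instance : ∀ k, Fintype (StkSym k)
  | .inp => inferInstanceAs (Fintype Bool)
  | .out => inferInstanceAs (Fintype (Option Bool))
  | .tick => inferInstanceAs (Fintype Unit)
  | .hi => inferInstanceAs (Fintype Bool)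
  | .lo => inferInstanceAs (Fintype Bool)
  | .fwd => inferInstanceAs (Fintype (Fin 4 → Bool))
  | .bwd => inferInstanceAs (Fintype (Fin 4 → Bool))

/-- The registers hold the symbol last read from each stack. -/
abbrev Reg := ∀ k, Option (StkSym k)

/-- Bit strings of length at most 21. -/
abbrev Prefix := {l : List Bool // l.length ≤ 21}

/-- Appends a bit, unless the string is full. -/
def Prefix.snoc (T : Prefix) (b : Bool) : Prefix := ⟨(T.1 ++ [b]).take 21, by simp⟩

instance : Finite Prefix := (List.finite_length_le Bool 21).to_subtype

/-- The constants depend only on bounded prefixes, of which there are finitely many. -/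
theorem exists_carryBound : ∃ B : ℤ, 3 ≤ B ∧ ∀ (T : Prefix) (even : Bool) (V : Prefix) (i : Fin 4),
    |(coeffs T.1 even V.1).low i| ≤ B ∧ |midCarry T.1 even V.1 i| ≤ B := by
  obtain ⟨B, hB⟩ := (Set.finite_range fun x : Prefix × Bool × Prefix × Fin 4 =>
    |(coeffs x.1.1 x.2.1 x.2.2.1.1).low x.2.2.2| + |midCarry x.1.1 x.2.1 x.2.2.1.1 x.2.2.2|).bddAbove
  refine ⟨max B 3, le_max_right _ _, fun T even V i => ?_⟩
  have h := hB ⟨(T, even, V, i), rfl⟩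
  have h1 := abs_nonneg ((coeffs T.1 even V.1).low i)
  have h2 := abs_nonneg (midCarry T.1 even V.1 i)
  simp only at h
  omega

/-- A bound for the constants that enter the additions. -/
noncomputable def carryBound : ℤ := exists_carryBound.choose

/-- Bounded carries. -/
abbrev Carry := Fin 4 → Set.Icc (-(2 * carryBound)) (2 * carryBound)

theorem three_le_carryBound : 3 ≤ carryBound := exists_carryBound.choose_spec.1

/-- Truncation of carries to bounded carries. -/
noncomputable def Carry.of (c : Fin 4 → ℤ) : Carry :=
  fun i => Set.projIcc _ _ (by have := three_le_carryBound; omega) (c i)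

/-- The carries as integers. -/
def Carry.val (c : Carry) : Fin 4 → ℤ := fun i => c i

theorem Carry.val_of {c : Fin 4 → ℤ} (h : ∀ i, |c i| ≤ 2 * carryBound) : (Carry.of c).val = c := by
  funext i
  simp only [Carry.val, Carry.of]
  rw [Set.projIcc_of_mem _ (Set.mem_Icc.2 (abs_le.1 (h i)))]

/-- The control states. -/
inductive Lbl
  | read (T : Prefix) (even : Bool)
  | clear (T : Prefix)
  | split (T : Prefix) (even : Bool)
  | peel (T : Prefix) (even : Bool) (V : Prefix)
  | back (T : Prefix) (even : Bool) (V : Prefix)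
  | low (T : Prefix) (even : Bool) (V : Prefix) (c : Carry)
  | high (c : Carry)
  | rev (i : Fin 4) (again : Bool)
  | emit (i : Fin 4) (again : Bool)
  | trim (i : Fin 4) (again : Bool)
  | clean

instance : Finite Lbl := by
  let f : (Prefix × Bool) ⊕ Prefix ⊕ (Prefix × Bool) ⊕ (Prefix × Bool × Prefix) ⊕
      (Prefix × Bool × Prefix) ⊕ (Prefix × Bool × Prefix × Carry) ⊕ Carry ⊕
      (Fin 4 × Bool) ⊕ (Fin 4 × Bool) ⊕ (Fin 4 × Bool) ⊕ Unit → Lbl :=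
    Sum.elim (fun x => .read x.1 x.2) <| Sum.elim .clear <| Sum.elim (fun x => .split x.1 x.2) <|
    Sum.elim (fun x => .peel x.1 x.2.1 x.2.2) <| Sum.elim (fun x => .back x.1 x.2.1 x.2.2) <|
    Sum.elim (fun x => .low x.1 x.2.1 x.2.2.1 x.2.2.2) <| Sum.elim .high <|
    Sum.elim (fun x => .rev x.1 x.2) <| Sum.elim (fun x => .emit x.1 x.2) <|
    Sum.elim (fun x => .trim x.1 x.2) fun _ => .clean
  refine Finite.of_surjective f ?_
  rintro (⟨T, e⟩ | T | ⟨T, e⟩ | ⟨T, e, V⟩ | ⟨T, e, V⟩ | ⟨T, e, V, c⟩ | c | ⟨i, a⟩ | ⟨i, a⟩ | ⟨i, a⟩ | _)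
  · exact ⟨.inl (T, e), rfl⟩
  · exact ⟨.inr <| .inl T, rfl⟩
  · exact ⟨.inr <| .inr <| .inl (T, e), rfl⟩
  · exact ⟨.inr <| .inr <| .inr <| .inl (T, e, V), rfl⟩
  · exact ⟨.inr <| .inr <| .inr <| .inr <| .inl (T, e, V), rfl⟩
  · exact ⟨.inr <| .inr <| .inr <| .inr <| .inr <| .inl (T, e, V, c), rfl⟩
  · exact ⟨.inr <| .inr <| .inr <| .inr <| .inr <| .inr <| .inl c, rfl⟩
  · exact ⟨.inr <| .inr <| .inr <| .inr <| .inr <| .inr <| .inr <| .inl (i, a), rfl⟩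
  · exact ⟨.inr <| .inr <| .inr <| .inr <| .inr <| .inr <| .inr <| .inr <| .inl (i, a), rfl⟩
  · exact ⟨.inr <| .inr <| .inr <| .inr <| .inr <| .inr <| .inr <| .inr <| .inr <| .inl (i, a), rfl⟩
  · exact ⟨.inr <| .inr <| .inr <| .inr <| .inr <| .inr <| .inr <| .inr <| .inr <| .inr (), rfl⟩

/-- The four roots for a small number. -/
noncomputable def smallRoots (N : ℕ) : Fin 4 → ℕ :=
  if h : 686 < N ∧ N < 2 ^ 20 then (exists_four_binSq_small h.1 h.2).choose else 0

theorem sum_smallRoots {N : ℕ} (h : 686 < N ∧ N < 2 ^ 20) : ∑ i, binSq (smallRoots N i) = N := by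
  rw [smallRoots, dif_pos h]
  exact (exists_four_binSq_small h.1 h.2).choose_spec

/-- The program statements of the machine. -/
abbrev Stm := TM2.Stmt StkSym Lbl Reg

/-- Pops a symbol into the register of the stack. -/
def fetch (k : Stk) (q : Stm) : Stm := .pop k (fun v o => Function.update v k o) q

/-- Pushes the symbols of a list, the first one first. -/
def pushAll (k : Stk) : List (StkSym k) → Stm → Stm
  | [], q => q
  | a :: l, q => .push k (fun _ => a) (pushAll k l q)

/-- Halts in the initial state. -/
def finish : Stm := .load (fun _ _ => none) .halt

/-- The program. -/
noncomputable def program : Lbl → Stm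
  | .read T even => fetch .inp <| .branch (fun v => (v .inp).isSome)
      (.push .hi (fun v => (v .inp).getD false) <|
        -- One tick for every other bit, from the first on: (n + 1) / 2 ticks for n bits.
        (if even then .push .tick (fun _ => ()) else id) <|
          .goto fun v => .read (T.snoc ((v .inp).getD false)) !even)
      -- With 21 bits the lower part always has room for the 8 bits of V; fewer bits mean N < 2^20,
      -- answered from the table.
      (if T.1.length < 21 then .goto fun _ => .clear T else
        -- Removing 1 or 3 ticks leaves exactly the length of the lower part.
        fetch .tick <| (if isLong T.1 even then fetch .tick ∘ fetch .tick else id) <|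
          .goto fun _ => .split T even)
  | .clear T => fetch .tick <| fetch .hi <| .branch (fun v => (v .hi).isSome)
      (.goto fun _ => .clear T)
      (pushAll .out (encodeQuadruple fun i => binSq (smallRoots (msbVal T.1) i)).reverse finish)
  | .split T even => fetch .tick <| .branch (fun v => (v .tick).isSome)
      (fetch .hi <| .push .lo (fun v => (v .hi).getD false) <| .goto fun _ => .split T even)
      (.goto fun _ => .peel T even ⟨[], by simp⟩)
  | .peel T even V => if V.1.length = 8 then .goto fun _ => .back T even V else
      fetch .lo <| .goto fun v => .peel T even (V.snoc ((v .lo).getD false))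
  | .back T even V => fetch .lo <| .branch (fun v => (v .lo).isSome)
      (.push .inp (fun v => (v .lo).getD false) <| .goto fun _ => .back T even V)
      (.goto fun _ => .low T even V (.of (coeffs T.1 even V.1).low))
  | .low T even V c => fetch .inp <| .branch (fun v => (v .inp).isSome)
      (fetch .hi <|
        .push .fwd (fun v => sumDigit c.val ((v .hi).getD false) ((v .inp).getD false)) <|
        .goto fun v =>
          .low T even V (.of (sumCarry c.val ((v .hi).getD false) ((v .inp).getD false))))
      (.goto fun _ => .high (.of (c.val + midCarry T.1 even V.1)))
  -- V is already in the carries, so the lower bit is 0 here. Printing starts with the last root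
  -- since the output is a stack.
  | .high c => fetch .hi <| .branch (fun v => (v .hi).isSome)
      (.push .fwd (fun v => sumDigit c.val ((v .hi).getD false) false) <|
        .goto fun v => .high (.of (sumCarry c.val ((v .hi).getD false) false)))
      (.push .out (fun _ => none) <| .goto fun _ => .rev 3 false)
  | .rev i again => fetch .fwd <| .branch (fun v => (v .fwd).isSome)
      (.push .bwd (fun v => (v .fwd).getD fun _ => false) <| .goto fun _ => .rev i again)
      (.goto fun _ => .emit i again)
  | .emit i again => fetch .bwd <| .branch (fun v => (v .bwd).isSome)
      (.push .fwd (fun v => (v .bwd).getD fun _ => false) <|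
        .push .out (fun v => some ((v .bwd).getD (fun _ => false) i)) <|
        .goto fun _ => .emit i again)
      (.goto fun _ => .trim i again)
  | .trim i again => .peek .out (fun v o => Function.update v .out o) <|
      .branch (fun v => decide (v .out = some (some false)))
      (fetch .out <| .goto fun _ => .trim i again)
      (if again = false then .goto fun _ => .rev i true else
        if i = 0 then .goto fun _ => .clean else
        .push .out (fun _ => none) <| .goto fun _ => .rev (i - 1) false)
  | .clean => fetch .fwd <| .branch (fun v => (v .fwd).isSome) (.goto fun _ => .clean) finish

/-! ### Running time of each phase -/

/-- The contents of the stacks. -/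
def mem (i : List Bool) (o : List (Option Bool)) (t : List Unit) (h l : List Bool)
    (f b : List (Fin 4 → Bool)) : ∀ k, List (StkSym k)
  | .inp => i
  | .out => o
  | .tick => t
  | .hi => h
  | .lo => l
  | .fwd => f
  | .bwd => b

section mem

variable (i i' : List Bool) (o o' : List (Option Bool)) (t t' : List Unit) (h h' l l' : List Bool)
  (f f' b b' : List (Fin 4 → Bool))

@[simp] theorem mem_inp : mem i o t h l f b .inp = i := rfl
@[simp] theorem mem_out : mem i o t h l f b .out = o := rfl
@[simp] theorem mem_tick : mem i o t h l f b .tick = t := rfl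
@[simp] theorem mem_hi : mem i o t h l f b .hi = h := rfl
@[simp] theorem mem_lo : mem i o t h l f b .lo = l := rfl
@[simp] theorem mem_fwd : mem i o t h l f b .fwd = f := rfl
@[simp] theorem mem_bwd : mem i o t h l f b .bwd = b := rfl

@[simp] theorem update_mem_inp :
    Function.update (mem i o t h l f b) .inp i' = mem i' o t h l f b := by
  funext k; cases k <;> rfl
@[simp] theorem update_mem_out :
    Function.update (mem i o t h l f b) .out o' = mem i o' t h l f b := by
  funext k; cases k <;> rfl
@[simp] theorem update_mem_tick :
    Function.update (mem i o t h l f b) .tick t' = mem i o t' h l f b := by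
  funext k; cases k <;> rfl
@[simp] theorem update_mem_hi :
    Function.update (mem i o t h l f b) .hi h' = mem i o t h' l f b := by
  funext k; cases k <;> rfl
@[simp] theorem update_mem_lo :
    Function.update (mem i o t h l f b) .lo l' = mem i o t h l' f b := by
  funext k; cases k <;> rfl
@[simp] theorem update_mem_fwd :
    Function.update (mem i o t h l f b) .fwd f' = mem i o t h l f' b := by
  funext k; cases k <;> rfl
@[simp] theorem update_mem_bwd :
    Function.update (mem i o t h l f b) .bwd b' = mem i o t h l f b' := by
  funext k; cases k <;> rfl

end mem

/-- The machine gets from the control state `a` with stacks `A` to the control state `b` with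
stacks `B` in at most `t` steps, whatever the registers hold. -/
def Run (a : Lbl) (A : ∀ k, List (StkSym k)) (b : Option Lbl) (B : ∀ k, List (StkSym k)) (t : ℕ) :
    Prop :=
  ∀ v : Reg, ∃ w : Reg, ReachesIn (TM2.step program) ⟨some a, v, A⟩ ⟨b, w, B⟩ t

namespace Run

variable {a b : Lbl} {c : Option Lbl} {A B C : ∀ k, List (StkSym k)} {s t : ℕ}

theorem refl (a : Lbl) (A) : Run a A (some a) A 0 := fun v => ⟨v, .refl _⟩

theorem trans (h₁ : Run a A (some b) B s) (h₂ : Run b B c C t) : Run a A c C (s + t) := fun v =>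
  let ⟨w, h₁⟩ := h₁ v
  let ⟨x, h₂⟩ := h₂ w
  ⟨x, h₁.trans h₂⟩

theorem mono (h : Run a A c C s) (hst : s ≤ t) : Run a A c C t := fun v =>
  let ⟨w, ⟨h⟩⟩ := h v
  ⟨w, ⟨⟨h.toEvalsTo, h.steps_le_m.trans hst⟩⟩⟩

theorem single (h : ∀ v, (TM2.stepAux (program a) v A).l = c ∧
    (TM2.stepAux (program a) v A).stk = C) : Run a A c C 1 := fun v =>
  ⟨(TM2.stepAux (program a) v A).var, .single (by
    obtain ⟨rfl, rfl⟩ := h v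
    rfl)⟩

theorem head (h : ∀ v, (TM2.stepAux (program a) v A).l = some b ∧
    (TM2.stepAux (program a) v A).stk = B)
    (h₂ : Run b B c C t) : Run a A c C (t + 1) :=
  add_comm 1 t ▸ (single h).trans h₂

end Run

variable {o : List (Option Bool)} {i h l : List Bool} {u : List Unit} {f b : List (Fin 4 → Bool)}

theorem Prefix.snoc_val (T : Prefix) (b : Bool) : (T.snoc b).1 = (T.1 ++ [b]).take 21 := rfl

theorem run_read (pre rest : List Bool) (T T' : Prefix) (hT : T.1 = pre.take 21)
    (hT' : T'.1 = (pre ++ rest).take 21) :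
    Run (.read T (pre.length % 2 = 0)) (mem rest o (List.replicate ((pre.length + 1) / 2) ())
      pre.reverse l f b)
      (some (.read T' ((pre ++ rest).length % 2 = 0))) (mem [] o
        (List.replicate (((pre ++ rest).length + 1) / 2) ()) (pre ++ rest).reverse l f b)
      rest.length := by
  induction rest generalizing pre T with
  | nil =>
    obtain rfl : T = T' := Subtype.ext (by rw [hT, hT', List.append_nil])
    simpa using Run.refl _ _
  | cons x rest ih =>
    have h := ih (pre ++ [x]) (T.snoc x) ?_ (by simpa using hT')
    · rw [List.append_assoc, List.singleton_append] at h
      refine Run.head (fun v => ?_) h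
      by_cases he : pre.length % 2 = 0
      · have h1 : (pre.length + 1) % 2 = 1 := by omega
        have h2 : (pre.length + 1 + 1) / 2 = (pre.length + 1) / 2 + 1 := by omega
        simp [program, fetch, he, h1, h2, List.replicate_succ]
      · have h1 : (pre.length + 1) % 2 = 0 := by omega
        have h2 : (pre.length + 1 + 1) / 2 = (pre.length + 1) / 2 := by omega
        simp [program, fetch, he, h1, h2]
    · rw [Prefix.snoc_val, hT]
      simp only [List.take_append, List.length_take]
      grind

theorem run_split (T : Prefix) (even : Bool) (low : List Bool) :
    Run (.split T even) (mem i o (List.replicate low.length ()) (low ++ h) l f b)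
      (some (.peel T even ⟨[], by simp⟩)) (mem i o [] h (low.reverse ++ l) f b)
      (low.length + 1) := by
  induction low generalizing l with
  | nil =>
    refine Run.single fun v => ?_
    simp [program, fetch]
  | cons x low ih =>
    refine Run.head (fun v => ?_) (by simpa using ih (l := x :: l))
    simp [program, fetch, List.replicate_succ]

theorem run_peel (T : Prefix) (even : Bool) (V W : Prefix) (m : List Bool)
    (hW : W.1 = V.1 ++ m) (h8 : W.1.length = 8) :
    Run (.peel T even V) (mem i o u h (m ++ l) f b)
      (some (.back T even W)) (mem i o u h l f b) (m.length + 1) := by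
  induction m generalizing V with
  | nil =>
    obtain rfl : W = V := Subtype.ext (by simpa using hW)
    refine Run.single fun v => ?_
    simp [program, h8]
  | cons x m ih =>
    have hV : (V.snoc x).1 = V.1 ++ [x] := by
      rw [Prefix.snoc_val, List.take_of_length_le]
      rw [hW] at h8
      simp at h8 ⊢
      omega
    have hV8 : V.1.length ≠ 8 := by
      rw [hW] at h8
      simp at h8
      omega
    refine Run.head (fun v => ?_) (ih (V.snoc x) (by simp [hV, hW]))
    simp [program, fetch, hV8]

theorem run_back (T : Prefix) (even : Bool) (V : Prefix) :
    Run (.back T even V) (mem i o u h l f b)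
      (some (.low T even V (.of (coeffs T.1 even V.1).low)))
      (mem (l.reverse ++ i) o u h [] f b) (l.length + 1) := by
  induction l generalizing i with
  | nil =>
    refine Run.single fun v => ?_
    simp [program, fetch]
  | cons x l ih =>
    refine Run.head (fun v => ?_) (by simpa using ih (i := x :: i))
    simp [program, fetch]

theorem run_low (T : Prefix) (even : Bool) (V : Prefix) (c : Fin 4 → ℤ)
    (hc : ∀ i, |c i| ≤ carryBound) (hi' : h.length = i.length) (h₂ : List Bool) :
    Run (.low T even V (.of c)) (mem i o u (h ++ h₂) l f b)
      (some (.high (.of (endCarry c (h.zip i) + midCarry T.1 even V.1))))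
      (mem [] o u h₂ l ((sumCols c (h.zip i)).reverse ++ f) b) (i.length + 1) := by
  have hv : (Carry.of c).val = c := Carry.val_of fun i =>
    (hc i).trans (by have := three_le_carryBound; omega)
  induction i generalizing h c f with
  | nil =>
    obtain rfl : h = [] := by simpa using hi'
    refine Run.single fun v => ?_
    simp [program, fetch, sumCols, endCarry, hv]
  | cons x i ih =>
    obtain ⟨y, h, rfl⟩ : ∃ y h', h = y :: h' := by
      cases h with
      | nil => simp at hi'
      | cons y h => exact ⟨y, h, rfl⟩
    have hc' := abs_sumCarry_le three_le_carryBound hc y x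
    refine Run.head (fun v => ?_) (by
      simpa [sumCols, endCarry] using ih (h := h) (f := sumDigit c y x :: f) (sumCarry c y x) hc'
        (by simpa using hi') (Carry.val_of fun i =>
          (hc' i).trans (by have := three_le_carryBound; omega)))
    simp [program, fetch, hv]

theorem run_high (c : Fin 4 → ℤ) (hc : ∀ i, |c i| ≤ 2 * carryBound) :
    Run (.high (.of c)) (mem i o u h l f b) (some (.rev 3 false))
      (mem i (none :: o) u [] l ((sumCols c (h.map fun b => (b, false))).reverse ++ f) b)
      (h.length + 1) := by
  have hv : (Carry.of c).val = c := Carry.val_of hc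
  induction h generalizing c f with
  | nil =>
    refine Run.single fun v => ?_
    simp [program, fetch, sumCols]
  | cons x h ih =>
    have hc' := abs_sumCarry_le (by have := three_le_carryBound; omega) hc x false
    refine Run.head (fun v => ?_) (by
      simpa [sumCols] using ih (f := sumDigit c x false :: f) (sumCarry c x false) hc'
        (Carry.val_of hc'))
    simp [program, fetch, hv]

theorem run_rev (j : Fin 4) (again : Bool) :
    Run (.rev j again) (mem i o u h l f b) (some (.emit j again))
      (mem i o u h l [] (f.reverse ++ b)) (f.length + 1) := by
  induction f generalizing b with
  | nil =>
    refine Run.single fun v => ?_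
    simp [program, fetch]
  | cons x f ih =>
    refine Run.head (fun v => ?_) (by simpa using ih (b := x :: b))
    simp [program, fetch]

theorem run_emit (j : Fin 4) (again : Bool) :
    Run (.emit j again) (mem i o u h l f b) (some (.trim j again))
      (mem i ((b.map fun c => some (c j)).reverse ++ o) u h l (b.reverse ++ f) [])
      (b.length + 1) := by
  induction b generalizing o f with
  | nil =>
    refine Run.single fun v => ?_
    simp [program, fetch]
  | cons x b ih =>
    refine Run.head (fun v => ?_) (by
      simpa using ih (o := some (x j) :: o) (f := x :: f))
    simp [program, fetch]

/-- The control state and the output after printing. -/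
def afterPrint (j : Fin 4) (again : Bool) (o : List (Option Bool)) : Lbl × List (Option Bool) :=
  if again = false then (.rev j true, o)
  else if j = 0 then (.clean, o) else (.rev (j - 1) false, none :: o)

-- The hypothesis on `o` makes trimming stop at a marker or at the leading 1 of the first copy.
theorem run_trim (j : Fin 4) (again : Bool) (d : List Bool) (ho : o.head? ≠ some (some false)) :
    Run (.trim j again) (mem i (d.map some ++ o) u h l f b)
      (some (afterPrint j again ((d.dropWhile (!·)).map some ++ o)).1)
      (mem i (afterPrint j again ((d.dropWhile (!·)).map some ++ o)).2 u h l f b)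
      (d.length + 1) := by
  have base : ∀ o' : List (Option Bool), o'.head? ≠ some (some false) →
      Run (.trim j again) (mem i o' u h l f b) (some (afterPrint j again o').1)
        (mem i (afterPrint j again o').2 u h l f b) 1 := by
    intro o' ho'
    refine Run.single fun v => ?_
    cases again
    · simp [program, afterPrint, ho']
    · by_cases hj : j = 0
      · simp [program, afterPrint, ho', hj]
      · simp [program, afterPrint, ho', hj]
  induction d with
  | nil => exact base o ho
  | cons x d ih =>
    cases x with
    | true => exact (base _ (by simp)).mono (by simp)
    | false =>
      refine Run.head (fun v => ?_) (by simpa using ih)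
      simp [program, fetch]

/-- The machine gets from the control state `a` with stacks `A` to the halting state with initial
registers and stacks `C` in at most `t` steps, whatever the registers hold. -/
def Halts (a : Lbl) (A C : ∀ k, List (StkSym k)) (t : ℕ) : Prop :=
  ∀ v : Reg, ReachesIn (TM2.step program) ⟨some a, v, A⟩ ⟨none, fun _ => none, C⟩ t

namespace Halts

variable {a b : Lbl} {A B C : ∀ k, List (StkSym k)} {s t : ℕ}

theorem of_run (h₁ : Run a A (some b) B s) (h₂ : Halts b B C t) : Halts a A C (s + t) := fun v =>
  let ⟨w, h₁⟩ := h₁ v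
  h₁.trans (h₂ w)

theorem mono (h : Halts a A C s) (hst : s ≤ t) : Halts a A C t := fun v =>
  let ⟨h⟩ := h v
  ⟨⟨h.toEvalsTo, h.steps_le_m.trans hst⟩⟩

theorem single (h : ∀ v, TM2.stepAux (program a) v A = ⟨none, fun _ => none, C⟩) :
    Halts a A C 1 := fun v => .single (congrArg some (h v))

end Halts

theorem stepAux_pushAll_out (xs : List (Option Bool)) (q : Stm) (v : Reg) :
    TM2.stepAux (pushAll .out xs q) v (mem i o u h l f b)
      = TM2.stepAux q v (mem i (xs.reverse ++ o) u h l f b) := by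
  induction xs generalizing o with
  | nil => rfl
  | cons x xs ih => simp [pushAll, ih]

theorem halts_clear (T : Prefix) (hu : u.length ≤ h.length) :
    Halts (.clear T) (mem [] [] u h [] [] [])
      (mem [] (encodeQuadruple fun i => binSq (smallRoots (msbVal T.1) i)) [] [] [] [] [])
      (h.length + 1) := by
  induction h generalizing u with
  | nil =>
    obtain rfl : u = [] := by simpa using hu
    refine Halts.single fun v => ?_
    simp [program, fetch, stepAux_pushAll_out, finish]
  | cons x h ih =>
    refine (Halts.of_run (Run.single fun v => ?_) (ih (u := u.tail) ?_)).mono (by simp; omega)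
    · simp [program, fetch]
    · simp at hu ⊢; omega

theorem halts_clean : Halts .clean (mem i o u h l f b) (mem i o u h l [] b) (f.length + 1) := by
  induction f with
  | nil =>
    refine Halts.single fun v => ?_
    simp [program, fetch, finish]
  | cons x f ih =>
    refine (Halts.of_run (Run.single fun v => ?_) ih).mono (by simp; omega)
    simp [program, fetch]

/-! ### Printing each root twice -/

/-- The representation of a number on the output stack. -/
def outRep (N : ℕ) : List (Option Bool) := (binaryRep N).map some

theorem outRep_append_head (N : ℕ) (ho : o.head? ≠ some (some false)) :
    (outRep N ++ o).head? ≠ some (some false) := by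
  by_cases hN : N = 0
  · subst hN; simpa [outRep, binaryRep] using ho
  · have := binaryRep_pos_head hN
    rw [outRep, List.head?_append, List.head?_map, this]
    simp

/-- Reversing and emitting restores the columns, so they can be reused for every copy of every root.
-/
theorem run_print (j : Fin 4) (again : Bool) (cs : List (Fin 4 → Bool))
    (ho : o.head? ≠ some (some false)) :
    Run (.rev j again) (mem i o u h l cs.reverse [])
      (some (afterPrint j again (outRep (bitsVal (cs.map (· j))) ++ o)).1)
      (mem i (afterPrint j again (outRep (bitsVal (cs.map (· j))) ++ o)).2 u h l cs.reverse [])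
      (3 * cs.length + 3) := by
  have h1 := run_rev (o := o) (i := i) (h := h) (l := l) (u := u) (f := cs.reverse) (b := []) j again
  have h2 := run_emit (o := o) (i := i) (h := h) (l := l) (u := u) (f := []) (b := cs) j again
  have h3 := run_trim (i := i) (h := h) (l := l) (u := u) (f := cs.reverse) (b := []) j again
    (cs.map (· j)).reverse ho
  rw [← binaryRep_bitsVal, List.map_reverse, List.map_map] at h3
  simp only [List.reverse_reverse, List.append_nil] at h1 h2
  refine ((h1.trans h2).trans h3).mono ?_
  simp only [List.length_reverse, List.length_map]
  omega

theorem run_print_twice (j : Fin 4) (cs : List (Fin 4 → Bool)) (ho : o.head? ≠ some (some false)) :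
    Run (.rev j false) (mem i o u h l cs.reverse [])
      (some (afterPrint j true (outRep (binSq (bitsVal (cs.map (· j)))) ++ o)).1)
      (mem i (afterPrint j true (outRep (binSq (bitsVal (cs.map (· j)))) ++ o)).2 u h l
        cs.reverse []) (6 * cs.length + 6) := by
  have h1 := run_print (i := i) (h := h) (l := l) (u := u) j false cs ho
  have h2 := run_print (i := i) (h := h) (l := l) (u := u) j true cs
    (outRep_append_head (bitsVal (cs.map (· j))) ho)
  rw [← List.append_assoc] at h2
  rw [outRep, binaryRep_binSq, List.map_append]
  exact (h1.trans h2).mono (by omega)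

theorem halts_print (cs : List (Fin 4 → Bool)) :
    Halts (.rev 3 false) (mem i [none] u h l cs.reverse [])
      (mem i (encodeQuadruple fun j => binSq (bitsVal (cs.map (· j)))) u h l [] [])
      (25 * cs.length + 25) := by
  have h3 := run_print_twice (i := i) (h := h) (l := l) (u := u) 3 cs (o := [none]) (by simp)
  have h2 := fun o => run_print_twice (i := i) (h := h) (l := l) (u := u) 2 cs (o := none :: o)
    (by simp)
  have h1 := fun o => run_print_twice (i := i) (h := h) (l := l) (u := u) 1 cs (o := none :: o)
    (by simp)
  have h0 := fun o => run_print_twice (i := i) (h := h) (l := l) (u := u) 0 cs (o := none :: o)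
    (by simp)
  have hc := fun o => halts_clean (i := i) (o := o) (h := h) (l := l) (u := u) (f := cs.reverse)
    (b := [])
  have := Halts.of_run h3 (Halts.of_run (h2 _) (Halts.of_run (h1 _) (Halts.of_run (h0 _) (hc _))))
  have e : encodeQuadruple (fun j => binSq (bitsVal (cs.map (· j))))
      = outRep (binSq (bitsVal (cs.map (· 0)))) ++ none ::
        (outRep (binSq (bitsVal (cs.map (· 1)))) ++ none ::
        (outRep (binSq (bitsVal (cs.map (· 2)))) ++ none ::
        (outRep (binSq (bitsVal (cs.map (· 3)))) ++ [none]))) := by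
    simp [encodeQuadruple, outRep, List.ofFn_succ]
  rw [e]
  refine Halts.mono this ?_
  simp only [List.length_reverse]
  omega

/-! ### Cutting the input and the complete run -/

/-- The lengths of the four pieces of the input add up. -/
theorem leadLen_add_lowLen {bs : List Bool} (hn : 21 ≤ bs.length) :
    let even := decide (bs.length % 2 = 0)
    leadLen (bs.take 21) even + 2 * lowLen (bs.take 21) even bs.length = bs.length + 8 ∧
    8 ≤ lowLen (bs.take 21) even bs.length ∧
    lowLen (bs.take 21) even bs.length + (if isLong (bs.take 21) even then 3 else 1)
      = (bs.length + 1) / 2 := by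
  intro even
  have hC : isLong (bs.take 21) even = true → bs.length % 2 = 0 := by
    simp only [isLong, even, Bool.and_eq_true, decide_eq_true_eq]
    exact fun h => h.1
  unfold leadLen lowLen
  generalize isLong (bs.take 21) even = C at *
  by_cases he : bs.length % 2 = 0
  · cases C <;> simp [even, he] <;> omega
  · cases C
    · simp [even, he]; omega
    · simp [he] at hC

/-- The four roots for the number with binary representation `bs`. -/
noncomputable def rootsOf (bs : List Bool) (j : Fin 4) : ℕ :=
  if bs.length < 21 then smallRoots (msbVal bs) j else
    let T := bs.take 21
    let even := decide (bs.length % 2 = 0)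
    let w := leadLen T even
    let k := lowLen T even bs.length
    bitsVal ((rootCols T even ((bs.drop (w + (k - 8))).take 8) (bs.take w)
      ((bs.drop w).take (k - 8)) (bs.drop (w + (k - 8) + 8))).map (· j))

theorem exists_split {bs : List Bool} (hn : 21 ≤ bs.length) : ∃ U H V L : List Bool,
    U = bs.take (leadLen (bs.take 21) (decide (bs.length % 2 = 0))) ∧
    bs = U ++ H ++ V ++ L ∧ H.length = L.length ∧ V.length = 8 ∧
    V.length + L.length = lowLen (bs.take 21) (decide (bs.length % 2 = 0)) bs.length ∧
    ∀ j, rootsOf bs j = bitsVal ((rootCols (bs.take 21) (decide (bs.length % 2 = 0))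
      V U H L).map (· j)) := by
  obtain ⟨h1, h2, -⟩ := leadLen_add_lowLen hn
  have hr : ∀ j, rootsOf bs j = _ := fun j => if_neg (by omega)
  dsimp only at hr
  generalize leadLen (bs.take 21) (decide (bs.length % 2 = 0)) = w at *
  generalize lowLen (bs.take 21) (decide (bs.length % 2 = 0)) bs.length = k at *
  refine ⟨_, _, _, _, rfl, ?_, ?_, ?_, ?_, hr⟩
  · rw [← List.take_add, ← List.take_add, List.take_append_drop]
  · simp; omega
  · simp; omega
  · simp; omega

theorem sum_binSq_rootsOf {N : ℕ} (hN : 686 < N) : ∑ j, binSq (rootsOf (binaryRep N) j) = N := by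
  by_cases hn : (binaryRep N).length < 21
  · have h : N < 2 ^ 20 := by
      rw [length_binaryRep] at hn
      exact Nat.size_le.1 (by omega)
    simp only [rootsOf, hn, if_true, msbVal_binaryRep]
    exact sum_smallRoots ⟨hN, h⟩
  · obtain ⟨U, H, V, L, hU, hbs, hHL, hV, -, hr⟩ := exists_split (not_lt.1 hn)
    simp only [hr]
    rw [sum_binSq_rootCols_of_split (binaryRep_pos_head (by omega)) (not_lt.1 hn) _ hU hHL hV hbs,
      msbVal_binaryRep]

theorem run_drop {n : ℕ} (T : Prefix) (even : Bool) (hT : T.1.length = 21) :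
    Run (.read T even) (mem [] o (List.replicate (n + if isLong T.1 even then 3 else 1) ()) h l f b)
      (some (.split T even)) (mem [] o (List.replicate n ()) h l f b) 1 := by
  refine Run.single fun v => ?_
  by_cases hC : isLong T.1 even = true
  · simp [program, fetch, hT, hC, List.replicate_succ]
  · simp [program, fetch, hT, hC, List.replicate_succ]

theorem halts_read (bs : List Bool) :
    Halts (.read ⟨[], by simp⟩ true) (mem bs [] [] [] [] [] [])
      (mem [] (encodeQuadruple fun j => binSq (rootsOf bs j)) [] [] [] [] [])
      (40 * bs.length + 40) := by
  have h1 := run_read (o := []) (l := []) (f := []) (b := []) [] bs ⟨[], by simp⟩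
    ⟨bs.take 21, by simp⟩ rfl rfl
  simp only [List.length_nil, List.nil_append, List.reverse_nil] at h1
  by_cases hn : bs.length < 21
  · have h2 : Run (.read ⟨bs.take 21, by simp⟩ (decide (bs.length % 2 = 0)))
        (mem [] [] (List.replicate ((bs.length + 1) / 2) ()) bs.reverse [] [] [])
        (some (.clear ⟨bs.take 21, by simp⟩))
        (mem [] [] (List.replicate ((bs.length + 1) / 2) ()) bs.reverse [] [] []) 1 :=
      Run.single fun v => by simp [program, fetch, hn]
    have h3 := halts_clear (u := List.replicate ((bs.length + 1) / 2) ()) (h := bs.reverse)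
      ⟨bs.take 21, by simp⟩ (by simp; omega)
    have e : rootsOf bs = smallRoots (msbVal (bs.take 21)) := by
      funext j
      rw [rootsOf, if_pos hn, List.take_of_length_le hn.le]
    rw [e]
    refine (Halts.of_run h1 (Halts.of_run h2 h3)).mono ?_
    simp; omega
  · rw [not_lt] at hn
    obtain ⟨-, -, hk⟩ := leadLen_add_lowLen hn
    obtain ⟨U, H, V, L, hU, hbs, hHL, hV, hVL, hr⟩ := exists_split hn
    simp only [hr]
    have hlen : bs.length = U.length + H.length + V.length + L.length := by
      conv_lhs => rw [hbs]
      simp [add_assoc]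
    generalize decide (bs.length % 2 = 0) = even at *
    obtain ⟨T, hT⟩ : ∃ T : Prefix, T.1 = bs.take 21 := ⟨⟨_, by simp⟩, rfl⟩
    obtain ⟨W, hW⟩ : ∃ W : Prefix, W.1 = V := ⟨⟨V, by omega⟩, rfl⟩
    have hT' : (⟨bs.take 21, by simp⟩ : Prefix) = T := Subtype.ext hT.symm
    rw [hT'] at h1
    rw [← hT] at hk ⊢
    have hB := exists_carryBound.choose_spec.2 T even W
    have h2 := run_drop (o := []) (h := bs.reverse) (l := []) (f := []) (b := [])
      (n := lowLen T.1 even bs.length) T even (by simp [hT, hn])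
    rw [hk] at h2
    have h3 := run_split (i := []) (o := []) (h := (U ++ H).reverse) (l := []) (f := []) (b := [])
      T even (V ++ L).reverse
    have e3 : bs.reverse = (V ++ L).reverse ++ (U ++ H).reverse := by
      conv_lhs => rw [hbs]
      simp
    have e4 : (V ++ L).reverse.length = lowLen T.1 even bs.length := by
      rw [List.length_reverse, List.length_append, hVL, hT]
    rw [← e3, List.reverse_reverse, List.append_nil, e4] at h3
    have h4 := run_peel (i := []) (o := []) (u := []) (h := (U ++ H).reverse) (l := L) (f := [])
      (b := []) T even ⟨[], by simp⟩ W V hW (by rw [hW, hV])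
    have h5 := run_back (i := []) (o := []) (u := []) (h := (U ++ H).reverse) (l := L) (f := [])
      (b := []) T even W
    have h6 := run_low (i := L.reverse) (o := []) (u := []) (h := H.reverse) (l := []) (f := [])
      (b := []) T even W _ (fun i => (hB i).1) (by simp [hHL]) U.reverse
    rw [← List.reverse_append] at h6
    -- Carries from the low part and the constants added at P are each at most `carryBound`; hence
    -- the factor 2 in `Carry`, whose truncation never acts.
    have hc : ∀ i, |(endCarry (coeffs T.1 even W.1).low (H.reverse.zip L.reverse)
        + midCarry T.1 even W.1) i| ≤ 2 * carryBound := by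
      intro i
      have a1 := abs_endCarry_le three_le_carryBound (fun i => (hB i).1)
        (H.reverse.zip L.reverse) i
      have a2 := abs_add_le (endCarry (coeffs T.1 even W.1).low (H.reverse.zip L.reverse) i)
        (midCarry T.1 even W.1 i)
      have a3 := (hB i).2
      rw [Pi.add_apply]
      change _ ≤ carryBound at a3
      linarith
    have h7 := run_high (i := []) (o := []) (u := []) (h := U.reverse) (l := [])
      (f := (sumCols (coeffs T.1 even W.1).low (H.reverse.zip L.reverse)).reverse) (b := []) _ hc
    rw [← List.reverse_append] at h7
    have h8 := halts_print (i := []) (u := []) (h := []) (l := []) (rootCols T.1 even W.1 U H L)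
    simp only [List.append_nil] at h5 h6
    have hcs : (rootCols T.1 even W.1 U H L).length = H.length + U.length := by
      simp [rootCols, length_sumCols, hHL]
    rw [hW] at h8 hcs
    rw [hW] at h7
    refine (Halts.of_run h1 <| Halts.of_run h2 <| Halts.of_run h3 <| Halts.of_run h4 <|
      Halts.of_run h5 <| Halts.of_run h6 <| Halts.of_run (by rw [hW]; exact h7) h8).mono ?_
    simp only [List.length_reverse, hcs]
    omega

/-! ### Assembly and the logarithmic bound -/

/-- The machine. -/
noncomputable def squaresMachine : FinTM2 where
  K := Stk
  k₀ := .inp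
  k₁ := .out
  Γ := StkSym
  Λ := Lbl
  main := .read ⟨[], by simp⟩ true
  ΛFin := Fintype.ofFinite Lbl
  σ := Reg
  initialState := fun _ => none
  m := program

theorem initList_squaresMachine (bs : List Bool) : initList squaresMachine bs
    = ⟨some (.read ⟨[], by simp⟩ true), fun _ => none, mem bs [] [] [] [] [] []⟩ := by
  unfold initList
  congr 1
  funext k
  cases k <;> rfl

theorem haltList_squaresMachine (o : List (Option Bool)) : haltList squaresMachine o
    = ⟨none, fun _ => none, mem [] o [] [] [] [] []⟩ := by
  unfold haltList
  congr 1
  funext k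
  cases k <;> rfl

theorem squaresMachine_outputs {bs bs' : List Bool} {o : List (Option Bool)} (hbs : bs' = bs)
    (ho : o = encodeQuadruple fun j => binSq (rootsOf bs j)) :
    Nonempty (TM2OutputsInTime squaresMachine bs' (some o) (40 * bs.length + 40)) := by
  subst hbs ho
  have h : ReachesIn squaresMachine.step (initList squaresMachine bs')
      (haltList squaresMachine (encodeQuadruple fun j => binSq (rootsOf bs' j)))
      (40 * bs'.length + 40) := by
    rw [initList_squaresMachine, haltList_squaresMachine]
    exact halts_read bs' fun _ => none
  exact h

/-- The four binary squares as a function computed by the machine. -/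
noncomputable def squaresMachineComputable :
    TM2ComputableInTime (fun N : {N : ℕ // 686 < N} => binaryRep (N : ℕ)) encodeQuadruple
      (fun N j => binSq (rootsOf (binaryRep N) j)) where
  tm := squaresMachine
  inputAlphabet := Equiv.refl Bool
  outputAlphabet := Equiv.refl (Option Bool)
  time n := 40 * n + 40
  outputsFun _ := (squaresMachine_outputs (List.map_id _) (List.map_id _)).some

theorem time_le_log {N : ℕ} (hN : 686 < N) :
    ((40 * (binaryRep N).length + 40 : ℕ) : ℝ) ≤ 200 * Real.log N := by
  have h1 : 2 ^ ((binaryRep N).length - 1) ≤ N := by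
    rw [length_binaryRep]
    exact Nat.lt_size.1 (Nat.sub_lt (Nat.size_pos.2 (by omega)) one_pos)
  have h2 : 10 ≤ (binaryRep N).length := by
    rw [length_binaryRep]
    exact Nat.lt_size.2 (by omega)
  obtain ⟨m, hm⟩ : ∃ m, (binaryRep N).length = m + 1 := ⟨_, (Nat.sub_add_cancel (by omega)).symm⟩
  rw [hm] at h1 h2 ⊢
  have h3 : (m : ℝ) * Real.log 2 ≤ Real.log N := by
    rw [← Real.log_pow]
    exact Real.log_le_log (by positivity) (by exact_mod_cast h1)
  have h4 : (9 : ℝ) ≤ m := by exact_mod_cast Nat.le_of_lt_succ (by omega)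
  have h5 := Real.log_two_gt_d9
  push_cast
  nlinarith

theorem mainTheorem9 :
    ∃ f : {N : ℕ // 686 < N} → (Fin 4 → ℕ),
      (∀ N : {N : ℕ // 686 < N},
        (∀ i : Fin 4, IsBinarySquare (f N i)) ∧ ∑ i : Fin 4, f N i = (N : ℕ)) ∧
      ∃ (M : Turing.TM2ComputableInTime
            (fun N : {N : ℕ // 686 < N} => binaryRep (N : ℕ)) encodeQuadruple f) (C : ℝ),
        (∀ k : M.tm.K, Finite (M.tm.Γ k)) ∧
        ∀ N : {N : ℕ // 686 < N},
          (M.time (binaryRep (N : ℕ)).length : ℝ) ≤ C * Real.log ((N : ℕ) : ℝ) := by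
  refine ⟨fun N j => binSq (rootsOf (binaryRep N) j), fun N =>
    ⟨fun j => isBinarySquare_binSq _, sum_binSq_rootsOf N.2⟩,
    squaresMachineComputable, 200, fun k => ?_, fun N => time_le_log N.2⟩
  have h : ∀ k : Stk, Finite (StkSym k) := fun k => inferInstance
  exact h k
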